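/- Let $\Omega_X$ be a Polish space with its Borel $\sigma$-algebra, let $\pi$ be any probability measure on $\Omega_X\times\{0,1\}$, let $(X,Y)\sim\pi$, and let $\pi_X$ be the marginal distribution of $X$. For $1\le p\le\infty$ let $L^p(\Omega_X;\pi_X)$ be the space of ($\pi_X$-a.e. classes of) real-valued $p$-integrable (essentially bounded, if $p=\infty$) functions, and for $g\in L^p(\Omega_X;\pi_X)$ define the expected calibration error $$\mathrm{ECE}_\pi(g)=\mathbb{E}\big[\,\big|\,\mathbb{E}[Y\mid g(X)]-g(X)\,\big|\,\big].$$ Theorem. Let $1\le p\le\infty$, let $g\in L^p(\Omega_X;\pi_X)$, and set $g^*(x)=\mathbb{E}[Y\mid X=x]$ for $x\in\Omega_X$. Then the functional $\mathrm{ECE}_\pi:L^p(\Omega_X;\pi_X)\to\mathbb{R}$ is continuous at $g$ in the topology of $L^p$ if and only if $$\mathrm{ECE}_\pi(g)=\|g^*-g\|_{L^1(\Omega_X;\pi_X)}.$$ -/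

import Mathlib

open MeasureTheory ProbabilityTheory Topology
open scoped ENNReal

noncomputable section

/-- The label `Y`, as a real random variable on `Ω × {0, 1}`; the data variable `X` is `Prod.fst`. -/
def labelY {Ω : Type*} (z : Ω × Fin 2) : ℝ := ((z.2 : ℕ) : ℝ)

lemma measurable_labelY {Ω : Type*} [MeasurableSpace Ω] :
    Measurable (labelY : Ω × Fin 2 → ℝ) :=
  (Measurable.of_discrete (f := fun y : Fin 2 => ((y : ℕ) : ℝ))).comp measurable_snd

lemma integrable_labelY {Ω : Type*} [MeasurableSpace Ω] (π : Measure (Ω × Fin 2))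
    [IsFiniteMeasure π] : Integrable (labelY : Ω × Fin 2 → ℝ) π := by
  refine Integrable.of_bound measurable_labelY.aestronglyMeasurable 1 (.of_forall fun z => ?_)
  have : (z.2 : ℕ) ≤ 1 := by omega
  simpa [labelY] using (by exact_mod_cast this : ((z.2 : ℕ) : ℝ) ≤ 1)

/-- The expected calibration error `𝔼 |𝔼[Y | g(X)] - g(X)|`, where `(X, Y) ∼ π` and `𝔼[· | g(X)]` is
the conditional expectation with respect to the `σ`-algebra generated by `g(X)`. -/
def expectedCalibrationError {Ω : Type*} [MeasurableSpace Ω] (π : Measure (Ω × Fin 2))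
    (g : Ω → ℝ) : ℝ :=
  ∫ z, |(π[labelY | MeasurableSpace.comap (fun z : Ω × Fin 2 => g z.1) inferInstance]) z - g z.1| ∂π

/-- The ground truth `g*(x) = 𝔼[Y | X = x]`: the mean of the regular conditional distribution of
`Y` given `X = x`. -/
def groundTruth {Ω : Type*} [MeasurableSpace Ω] (π : Measure (Ω × Fin 2)) [IsFiniteMeasure π]
    (x : Ω) : ℝ :=
  ∫ y, y ∂(condDistrib labelY Prod.fst π x)

/-- `g*(X)` is the conditional expectation of `Y` given `X`. -/
lemma groundTruth_comp_fst_ae_eq {Ω : Type*} [m : MeasurableSpace Ω] (π : Measure (Ω × Fin 2))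
    [IsFiniteMeasure π] :
    (fun z : Ω × Fin 2 => groundTruth π z.1) =ᵐ[π] π[labelY | m.comap Prod.fst] :=
  (condExp_ae_eq_integral_condDistrib' measurable_fst (integrable_labelY π)).symm

/-- The expected calibration error does not depend on the choice of a representative, so that it is
a functional on `L^p(Ω; π_X)`. -/
lemma expectedCalibrationError_congr {Ω : Type*} [MeasurableSpace Ω] (π : Measure (Ω × Fin 2))
    [IsProbabilityMeasure π] {g h : Ω → ℝ} (hg : Measurable g) (hh : Measurable h)
    (hgh : g =ᵐ[π.fst] h) :
    expectedCalibrationError π g = expectedCalibrationError π h := by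
  have hae : (fun z : Ω × Fin 2 => g z.1) =ᵐ[π] fun z => h z.1 :=
    ae_of_ae_map measurable_fst.aemeasurable hgh
  have h1 := condExp_ae_eq_integral_condDistrib' (μ := π) (hg.comp measurable_fst) (integrable_labelY π)
  have h2 := condExp_ae_eq_integral_condDistrib' (μ := π) (hh.comp measurable_fst) (integrable_labelY π)
  have h3 : condDistrib labelY (g ∘ Prod.fst) π = condDistrib labelY (h ∘ Prod.fst) π :=
    condDistrib_congr_right hae
  rw [h3] at h1
  refine integral_congr_ae ?_
  filter_upwards [h1, h2, hae] with z e1 e2 e3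
  simp only [Function.comp_def] at e1 e2
  rw [e1, e2, e3]

end

/-!
Write `U(f) = ‖g* - f‖_{L¹}`, a continuous functional on `L^p`. Conditioning `g*(X) - f(X)` on `f(X)`
gives `𝔼[Y | f(X)] - f(X)`, so `ECE ≤ U` everywhere (`expectedCalibrationError_le`). The theorem
follows from two further facts.

* `ECE` is lower semicontinuous (`expectedCalibrationError_lowerSemicontinuous`). By duality it is the
  supremum of the functionals `f ↦ 𝔼[φ(f(X)) (Y - f(X))]` over `φ ∈ C_c(ℝ)` with `|φ| ≤ 1`
  (`exists_expectedCalibrationError_le_integral_comp_mul_sub`), and each of these is continuous for the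
  `L¹` distance, since `φ` and `t ↦ t φ(t)` are uniformly continuous. Hence if `ECE(g) = U(g)`, then
  `ECE` is squeezed near `g` between a lower semicontinuous bound and the continuous `U`, which agree
  at `g`.
* The set `{ECE = U}` is dense, even for uniform approximation
  (`exists_abs_sub_le_expectedCalibrationError_eq`): a small perturbation of `g` can encode the value
  `g*(x)`, after which conditioning on it loses nothing. Hence if `ECE` is continuous at `g`, it agrees
  there with `U`.
-/

open Filter

/-! ### Test functions on the real line -/

/-- The duality between `L¹` and bounded functions, with test functions in `C_c(ℝ)`: approximate `k`
in `L¹(ν)` by `c ∈ C_c(ℝ)` and test against `c / (|c| + ε)`, a smoothed sign of `k`. -/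
lemma exists_hasCompactSupport_integral_abs_le_integral_mul {ν : Measure ℝ} [IsFiniteMeasure ν]
    {k : ℝ → ℝ} (hk : Integrable k ν) {ε : ℝ} (hε : 0 < ε) :
    ∃ φ : ℝ → ℝ, Continuous φ ∧ HasCompactSupport φ ∧ (∀ t, |φ t| ≤ 1) ∧
      ∫ t, |k t| ∂ν ≤ ∫ t, φ t * k t ∂ν + ε := by
  -- The loss is at most `2δ` from `∫ |k - c| ≤ δ` and `δ ν(ℝ)` from the smoothing.
  obtain ⟨δ, hδ, hδε⟩ : ∃ δ > 0, 2 * δ + δ * ν.real Set.univ ≤ ε := by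
    refine ⟨ε / (2 + ν.real Set.univ), by positivity, le_of_eq ?_⟩
    field_simp
  obtain ⟨c, hc_supp, hc_le, hc_cont, hc_int⟩ := hk.exists_hasCompactSupport_integral_sub_le hδ
  have hden (t : ℝ) : 0 < |c t| + δ := by positivity
  have hφ_cont : Continuous fun t => c t / (|c t| + δ) :=
    hc_cont.div (by fun_prop) fun t => (hden t).ne'
  have hφ_le (t : ℝ) : |c t / (|c t| + δ)| ≤ 1 := by
    rw [abs_div, abs_of_pos (hden t), div_le_one (hden t)]
    linarith
  refine ⟨fun t => c t / (|c t| + δ), hφ_cont, ?_, hφ_le, ?_⟩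
  · refine hc_supp.mono fun t ht => ?_
    simp only [Function.mem_support] at ht ⊢
    rintro h
    simp [h] at ht
  have hφk : Integrable (fun t => c t / (|c t| + δ) * k t) ν :=
    hk.bdd_mul hφ_cont.aestronglyMeasurable (.of_forall fun t => hφ_le t)
  have hpt (t : ℝ) : |k t| ≤ c t / (|c t| + δ) * k t + (2 * ‖k t - c t‖ + δ) := by
    have h1 : |k t| ≤ |c t| + |k t - c t| := by
      simpa using abs_add_le (c t) (k t - c t)
    have h2 : |c t| ≤ c t / (|c t| + δ) * c t + δ := by
      have e : c t / (|c t| + δ) * c t = |c t| ^ 2 / (|c t| + δ) := by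
        rw [sq_abs]; ring
      rw [e, ← sub_le_iff_le_add, le_div_iff₀ (hden t)]
      nlinarith
    have h3 : -(c t / (|c t| + δ) * (k t - c t)) ≤ |k t - c t| := by
      refine (neg_le_abs _).trans ?_
      rw [abs_mul]
      exact mul_le_of_le_one_left (abs_nonneg _) (hφ_le t)
    rw [Real.norm_eq_abs]
    linarith [mul_sub (c t / (|c t| + δ)) (k t) (c t)]
  have hkc : Integrable (fun t => 2 * ‖k t - c t‖) ν := (hk.sub hc_int).norm.const_mul 2
  have hkcδ : Integrable (fun t => 2 * ‖k t - c t‖ + δ) ν := hkc.add (integrable_const δ)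
  calc ∫ t, |k t| ∂ν
      ≤ ∫ t, (c t / (|c t| + δ) * k t + (2 * ‖k t - c t‖ + δ)) ∂ν :=
        integral_mono hk.abs (hφk.add hkcδ) hpt
    _ = ∫ t, c t / (|c t| + δ) * k t ∂ν + (2 * ∫ t, ‖k t - c t‖ ∂ν + δ * ν.real Set.univ) := by
        rw [integral_add hφk hkcδ, integral_add hkc (integrable_const δ),
          integral_const_mul, integral_const, smul_eq_mul, mul_comm δ]
    _ ≤ _ := by linarith

/-- A continuous compactly supported function is Lipschitz up to an arbitrarily small additive
error. -/
lemma HasCompactSupport.exists_abs_sub_le_add_mul {φ : ℝ → ℝ} (hs : HasCompactSupport φ)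
    (hc : Continuous φ) {η : ℝ} (hη : 0 < η) :
    ∃ C, 0 ≤ C ∧ ∀ s t, |φ s - φ t| ≤ η + C * |s - t| := by
  obtain ⟨M, hM⟩ := hs.exists_bound_of_continuous hc
  obtain ⟨δ, hδ, h⟩ :=
    Metric.uniformContinuous_iff.1 (hs.uniformContinuous_of_continuous hc) η hη
  have hM0 : 0 ≤ M := (norm_nonneg _).trans (hM 0)
  refine ⟨2 * M / δ, by positivity, fun s t => ?_⟩
  rcases lt_or_ge |s - t| δ with hst | hst
  · have h1 := (h (a := s) (b := t) hst).le
    have h2 : 0 ≤ 2 * M / δ * |s - t| := by positivity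
    rw [Real.dist_eq] at h1
    linarith
  · have h1 : |φ s - φ t| ≤ 2 * M := by
      have := norm_sub_le (φ s) (φ t)
      have h2 := hM s
      have h3 := hM t
      rw [Real.norm_eq_abs] at this
      linarith
    have h2 : 2 * M ≤ 2 * M / δ * |s - t| := by
      calc 2 * M = 2 * M / δ * δ := by field_simp
        _ ≤ _ := by gcongr
    linarith

/-! ### The expected calibration error -/

section CalibrationError

lemma abs_labelY_le_one {Ω : Type*} (z : Ω × Fin 2) : |labelY z| ≤ 1 := by
  have : (z.2 : ℕ) ≤ 1 := by omega
  simpa [labelY] using (by exact_mod_cast this : ((z.2 : ℕ) : ℝ) ≤ 1)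

variable {Ω : Type*} [MeasurableSpace Ω] {π : Measure (Ω × Fin 2)}

lemma integral_fst (F : Ω → ℝ) (hF : Measurable F) : ∫ x, F x ∂π.fst = ∫ z, F z.1 ∂π :=
  integral_map measurable_fst.aemeasurable hF.aestronglyMeasurable

lemma integrable_comp_fst {F : Ω → ℝ} (hF : Integrable F π.fst) :
    Integrable (fun z => F z.1) π :=
  hF.comp_measurable measurable_fst

variable [IsProbabilityMeasure π]

lemma measurable_groundTruth : Measurable (groundTruth π) :=
  (StronglyMeasurable.integral_condDistrib (f := fun q : Ω × ℝ => q.2)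
    measurable_snd.stronglyMeasurable).measurable

lemma integrable_groundTruth_comp_fst : Integrable (fun z => groundTruth π z.1) π :=
  integrable_condExp.congr (groundTruth_comp_fst_ae_eq π).symm

lemma integrable_groundTruth : Integrable (groundTruth π) π.fst :=
  (integrable_map_measure measurable_groundTruth.aestronglyMeasurable
    measurable_fst.aemeasurable).2 integrable_groundTruth_comp_fst

lemma comap_comp_fst_le {f : Ω → ℝ} (hf : Measurable f) :
    MeasurableSpace.comap (fun z : Ω × Fin 2 => f z.1) inferInstance ≤
      (inferInstance : MeasurableSpace (Ω × Fin 2)) :=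
  (hf.comp measurable_fst).comap_le

/-- The tower property: conditioning on `f(X)`, the label `Y` may be replaced by its conditional
expectation `g*(X)` given `X`. -/
lemma condExp_groundTruth_ae_eq {f : Ω → ℝ} (hf : Measurable f) :
    π[fun z => groundTruth π z.1 |
        MeasurableSpace.comap (fun z : Ω × Fin 2 => f z.1) inferInstance] =ᵐ[π]
      π[labelY | MeasurableSpace.comap (fun z : Ω × Fin 2 => f z.1) inferInstance] := by
  refine (condExp_congr_ae (groundTruth_comp_fst_ae_eq π)).trans
    (condExp_condExp_of_le ?_ measurable_fst.comap_le)
  rintro _ ⟨s, hs, rfl⟩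
  exact ⟨f ⁻¹' s, hf hs, rfl⟩

/-- Jensen's inequality: `𝔼[Y | f(X)] - f(X)` is the conditional expectation of `g*(X) - f(X)`
given `f(X)`. -/
lemma expectedCalibrationError_le {f : Ω → ℝ} (hf : Measurable f) (hfi : Integrable f π.fst) :
    expectedCalibrationError π f ≤ ∫ x, |groundTruth π x - f x| ∂π.fst := by
  have hm := comap_comp_fst_le hf
  have hfi' := integrable_comp_fst hfi
  have hsm : StronglyMeasurable[MeasurableSpace.comap (fun z : Ω × Fin 2 => f z.1) inferInstance]
      (fun z : Ω × Fin 2 => f z.1) :=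
    (comap_measurable (fun z : Ω × Fin 2 => f z.1)).stronglyMeasurable
  rw [integral_fst (fun x => |groundTruth π x - f x|) (measurable_groundTruth.sub hf).abs]
  refine le_trans (le_of_eq (integral_congr_ae ?_))
    (integral_abs_condExp_le (m := MeasurableSpace.comap (fun z : Ω × Fin 2 => f z.1) inferInstance)
      (μ := π) ((fun z => groundTruth π z.1) - fun z => f z.1))
  filter_upwards [condExp_groundTruth_ae_eq (π := π) hf,
    condExp_sub (integrable_groundTruth_comp_fst (π := π)) hfi'
      (MeasurableSpace.comap (fun z : Ω × Fin 2 => f z.1) inferInstance)] with z h1 h2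
  rw [h2, Pi.sub_apply, h1, condExp_of_stronglyMeasurable hm hsm hfi']

/-- Equality in Jensen's inequality when `f(X)` carries all the information in `g*(X)`. -/
lemma expectedCalibrationError_eq_of_groundTruth_eq_comp {T : ℝ → ℝ} {u : Ω → ℝ}
    (hu : Measurable u) (hT : Measurable T) (h : ∀ x, groundTruth π x = T (u x)) :
    expectedCalibrationError π u = ∫ x, |groundTruth π x - u x| ∂π.fst := by
  have hsm : StronglyMeasurable[MeasurableSpace.comap (fun z : Ω × Fin 2 => u z.1) inferInstance]
      (fun z : Ω × Fin 2 => groundTruth π z.1) := by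
    simp_rw [h]
    exact (hT.comp (comap_measurable (fun z : Ω × Fin 2 => u z.1))).stronglyMeasurable
  rw [integral_fst (fun x => |groundTruth π x - u x|) (measurable_groundTruth.sub hu).abs]
  refine integral_congr_ae ?_
  filter_upwards [condExp_groundTruth_ae_eq (π := π) hu] with z hz
  rw [← hz, condExp_of_stronglyMeasurable (comap_comp_fst_le hu) hsm
    integrable_groundTruth_comp_fst]

/-- The pairing of the calibration residual with a test function of `f(X)`. -/
lemma integral_comp_mul_condExp_sub {φ : ℝ → ℝ} {u : Ω → ℝ} (hu : Measurable u)
    (hui : Integrable u π.fst) (hφ : Continuous φ) (hφ1 : ∀ t, |φ t| ≤ 1) :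
    ∫ z, φ (u z.1) * ((π[labelY | MeasurableSpace.comap (fun z : Ω × Fin 2 => u z.1)
        inferInstance]) z - u z.1) ∂π =
      ∫ z, φ (u z.1) * (labelY z - u z.1) ∂π := by
  have hm := comap_comp_fst_le hu
  have hui' := integrable_comp_fst hui
  have hbdd {F : Ω × Fin 2 → ℝ} (hF : Integrable F π) :
      Integrable (fun z => φ (u z.1) * F z) π :=
    hF.bdd_mul (hφ.measurable.comp (hu.comp measurable_fst)).aestronglyMeasurable
      (.of_forall fun z => hφ1 _)
  have hsm : StronglyMeasurable[MeasurableSpace.comap (fun z : Ω × Fin 2 => u z.1) inferInstance]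
      (fun z : Ω × Fin 2 => φ (u z.1)) :=
    (hφ.measurable.comp (comap_measurable (fun z : Ω × Fin 2 => u z.1))).stronglyMeasurable
  have hpull := condExp_mul_of_stronglyMeasurable_left hsm (hbdd (integrable_labelY π))
    (integrable_labelY π)
  simp_rw [mul_sub]
  rw [integral_sub (hbdd integrable_condExp) (hbdd hui'),
    integral_sub (hbdd (integrable_labelY π)) (hbdd hui')]
  congr 1
  exact (integral_congr_ae hpull).symm.trans (integral_condExp hm)

lemma integral_comp_mul_sub_le_expectedCalibrationError {φ : ℝ → ℝ} {u : Ω → ℝ}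
    (hu : Measurable u) (hui : Integrable u π.fst) (hφ : Continuous φ) (hφ1 : ∀ t, |φ t| ≤ 1) :
    ∫ z, φ (u z.1) * (labelY z - u z.1) ∂π ≤ expectedCalibrationError π u := by
  have hint : Integrable (fun z => (π[labelY | MeasurableSpace.comap
      (fun z : Ω × Fin 2 => u z.1) inferInstance]) z - u z.1) π :=
    integrable_condExp.sub (integrable_comp_fst hui)
  rw [← integral_comp_mul_condExp_sub hu hui hφ hφ1]
  refine integral_mono (hint.bdd_mul (hφ.measurable.comp (hu.comp measurable_fst)).aestronglyMeasurable
      (.of_forall fun z => hφ1 _)) hint.abs fun z => (le_abs_self _).trans ?_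
  rw [abs_mul]
  exact mul_le_of_le_one_left (abs_nonneg _) (hφ1 _)

/-- Together with `integral_comp_mul_sub_le_expectedCalibrationError`, the dual formula: the expected
calibration error is the supremum of `𝔼[φ(u(X)) (Y - u(X))]` over the test functions `φ`. -/
lemma exists_expectedCalibrationError_le_integral_comp_mul_sub {u : Ω → ℝ}
    (hu : Measurable u) (hui : Integrable u π.fst) {ε : ℝ} (hε : 0 < ε) :
    ∃ φ : ℝ → ℝ, Continuous φ ∧ HasCompactSupport φ ∧ (∀ t, |φ t| ≤ 1) ∧
      expectedCalibrationError π u ≤ ∫ z, φ (u z.1) * (labelY z - u z.1) ∂π + ε := by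
  have hX : Measurable (fun z : Ω × Fin 2 => u z.1) := hu.comp measurable_fst
  -- By disintegration, the residual `𝔼[Y | u(X)] - u(X)` is `k(u(X))`.
  let k : ℝ → ℝ := fun t => ∫ y, y ∂(condDistrib labelY (fun z : Ω × Fin 2 => u z.1) π t) - t
  have hkm : Measurable k :=
    (StronglyMeasurable.integral_condDistrib (f := fun q : ℝ × ℝ => q.2)
      measurable_snd.stronglyMeasurable).measurable.sub measurable_id
  have hk : (fun z => (π[labelY | MeasurableSpace.comap
      (fun z : Ω × Fin 2 => u z.1) inferInstance]) z - u z.1) =ᵐ[π] fun z => k (u z.1) := by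
    filter_upwards [condExp_ae_eq_integral_condDistrib' (μ := π) hX (integrable_labelY π)] with z hz
    rw [hz]
  have hki : Integrable k (π.map fun z => u z.1) := by
    refine (integrable_map_measure hkm.aestronglyMeasurable hX.aemeasurable).2 ?_
    exact (integrable_condExp.sub (integrable_comp_fst hui)).congr hk
  obtain ⟨φ, hφ, hφs, hφ1, hle⟩ :=
    exists_hasCompactSupport_integral_abs_le_integral_mul hki hε
  refine ⟨φ, hφ, hφs, hφ1, ?_⟩
  rw [integral_map hX.aemeasurable hkm.abs.aestronglyMeasurable,
    integral_map hX.aemeasurable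
      (f := fun t => φ t * k t) (hφ.measurable.mul hkm).aestronglyMeasurable] at hle
  rw [← integral_comp_mul_condExp_sub hu hui hφ hφ1]
  calc expectedCalibrationError π u = ∫ z, |k (u z.1)| ∂π :=
        integral_congr_ae (hk.mono fun z hz => congrArg abs hz)
    _ ≤ _ := hle
    _ = _ := by
        congr 1
        exact integral_congr_ae (hk.mono fun z hz => congrArg (φ (u z.1) * ·) hz.symm)

/-- The expected calibration error is lower semicontinuous for the `L¹` distance, as a supremum of
continuous functionals. -/
lemma expectedCalibrationError_lowerSemicontinuous {u : Ω → ℝ}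
    (hu : Measurable u) (hui : Integrable u π.fst) {ε : ℝ} (hε : 0 < ε) :
    ∃ δ > 0, ∀ v : Ω → ℝ, Measurable v → Integrable v π.fst →
      ∫ x, |v x - u x| ∂π.fst < δ →
        expectedCalibrationError π u ≤ expectedCalibrationError π v + ε := by
  obtain ⟨φ, hφ, hφs, hφ1, hle⟩ :=
    exists_expectedCalibrationError_le_integral_comp_mul_sub hu hui (half_pos hε)
  -- `t ↦ φ t * t` is again continuous with compact support, which handles the unbounded factor.
  obtain ⟨C, hC, hφC⟩ := hφs.exists_abs_sub_le_add_mul hφ (η := ε / 8) (by positivity)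
  obtain ⟨D, hD, hψD⟩ := HasCompactSupport.exists_abs_sub_le_add_mul (φ := fun t => φ t * t)
    hφs.mul_right (hφ.mul continuous_id) (η := ε / 8) (by positivity)
  refine ⟨ε / 4 / (C + D + 1), by positivity, fun v hv hvi hvu => ?_⟩
  have hbdd {w : Ω → ℝ} (hw : Measurable w) (hwi : Integrable w π.fst) :
      Integrable (fun z => φ (w z.1) * (labelY z - w z.1)) π :=
    ((integrable_labelY π).sub (integrable_comp_fst hwi)).bdd_mul
      (hφ.measurable.comp (hw.comp measurable_fst)).aestronglyMeasurable
      (.of_forall fun z => hφ1 _)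
  have hpt (z : Ω × Fin 2) : φ (u z.1) * (labelY z - u z.1) ≤
      φ (v z.1) * (labelY z - v z.1) + (ε / 4 + (C + D) * |v z.1 - u z.1|) := by
    have h1 := hφC (v z.1) (u z.1)
    have h2 := (le_abs_self _).trans (hψD (v z.1) (u z.1))
    have h3 : (φ (u z.1) - φ (v z.1)) * labelY z ≤ |φ (v z.1) - φ (u z.1)| := by
      refine (le_abs_self _).trans ?_
      rw [abs_mul, abs_sub_comm]
      exact mul_le_of_le_one_right (abs_nonneg _) (abs_labelY_le_one z)
    linarith
  have hd : Integrable (fun z => (C + D) * |v z.1 - u z.1|) π :=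
    (integrable_comp_fst (hvi.sub hui)).abs.const_mul _
  have hd' : Integrable (fun z => ε / 4 + (C + D) * |v z.1 - u z.1|) π :=
    (integrable_const (ε / 4)).add hd
  have hJ : ∫ z, φ (u z.1) * (labelY z - u z.1) ∂π ≤
      ∫ z, φ (v z.1) * (labelY z - v z.1) ∂π +
        (ε / 4 + (C + D) * ∫ x, |v x - u x| ∂π.fst) := by
    rw [integral_fst (fun x => |v x - u x|) (hv.sub hu).abs]
    calc _ ≤ ∫ z, (φ (v z.1) * (labelY z - v z.1) + (ε / 4 + (C + D) * |v z.1 - u z.1|)) ∂π :=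
          integral_mono (hbdd hu hui)
            ((hbdd hv hvi).add hd') hpt
      _ = _ := by
          rw [integral_add (hbdd hv hvi) hd',
            integral_add (integrable_const (ε / 4)) hd, integral_const_mul]
          simp
  have hsmall : (C + D) * ∫ x, |v x - u x| ∂π.fst ≤ ε / 4 := by
    have h0 : 0 ≤ ∫ x, |v x - u x| ∂π.fst := integral_nonneg fun x => abs_nonneg _
    rw [lt_div_iff₀ (by positivity)] at hvu
    linarith
  linarith [integral_comp_mul_sub_le_expectedCalibrationError hv hvi hφ hφ1]

/-- Uniformly close to every `u` there is a predictor for which Jensen's inequality is an equality: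
round `u` down to a multiple of `η` and store `g*` in the fractional part. -/
lemma exists_abs_sub_le_expectedCalibrationError_eq {u : Ω → ℝ} (hu : Measurable u) {η : ℝ}
    (hη : 0 < η) :
    ∃ v : Ω → ℝ, Measurable v ∧ (∀ x, |v x - u x| ≤ η) ∧
      expectedCalibrationError π v = ∫ x, |groundTruth π x - v x| ∂π.fst := by
  have hfl : Measurable fun x => (⌊u x / η⌋ : ℝ) :=
    (measurable_from_top (f := fun n : ℤ => (n : ℝ))).comp (Int.measurable_floor.comp (hu.div_const η))
  have hsig : Measurable fun x => Real.sigmoid (groundTruth π x) :=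
    continuous_sigmoid.measurable.comp measurable_groundTruth
  have hv : Measurable fun x => η * (⌊u x / η⌋ + Real.sigmoid (groundTruth π x)) :=
    (hfl.add hsig).const_mul η
  refine ⟨_, hv, fun x => ?_, ?_⟩
  · have h1 := Int.floor_le (u x / η)
    have h2 := Int.lt_floor_add_one (u x / η)
    have h3 := Real.sigmoid_pos (groundTruth π x)
    have h4 := Real.sigmoid_lt_one (groundTruth π x)
    have e : η * (⌊u x / η⌋ + Real.sigmoid (groundTruth π x)) - u x =
        η * (⌊u x / η⌋ + Real.sigmoid (groundTruth π x) - u x / η) := by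
      field_simp
    rw [e, abs_mul, abs_of_pos hη]
    refine mul_le_of_le_one_right hη.le (abs_le.2 ⟨?_, ?_⟩) <;> linarith
  · -- The logit function inverts the sigmoid.
    refine expectedCalibrationError_eq_of_groundTruth_eq_comp hv
      (T := fun t => Real.log (Int.fract (t / η) / (1 - Int.fract (t / η)))) ?_ fun x => ?_
    · have hfr : Measurable fun t : ℝ => Int.fract (t / η) :=
        measurable_fract.comp (measurable_id.div_const η)
      exact Real.measurable_log.comp (hfr.div (measurable_const.sub hfr))
    · have hfr : Int.fract (Real.sigmoid (groundTruth π x)) = Real.sigmoid (groundTruth π x) :=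
        Int.fract_eq_self.2 ⟨Real.sigmoid_nonneg _, Real.sigmoid_lt_one _⟩
      have hlog : Real.sigmoid (groundTruth π x) / (1 - Real.sigmoid (groundTruth π x)) =
          Real.exp (groundTruth π x) := by
        have h0 : 1 - Real.sigmoid (groundTruth π x) ≠ 0 :=
          (sub_pos.2 (Real.sigmoid_lt_one _)).ne'
        rw [div_eq_iff h0, ← Real.sigmoid_neg, ← Real.sigmoid_mul_rexp_neg, mul_left_comm,
          ← Real.exp_add, add_neg_cancel, Real.exp_zero, mul_one]
      simp only [mul_div_cancel_left₀ _ hη.ne', Int.fract_intCast_add, hfr, hlog, Real.log_exp]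

lemma abs_integral_groundTruth_sub_sub_le {u v : Ω → ℝ} (hui : Integrable u π.fst)
    (hvi : Integrable v π.fst) :
    |∫ x, |groundTruth π x - v x| ∂π.fst - ∫ x, |groundTruth π x - u x| ∂π.fst| ≤
      ∫ x, |v x - u x| ∂π.fst := by
  have hv : Integrable (fun x => |groundTruth π x - v x|) π.fst :=
    (integrable_groundTruth.sub hvi).abs
  have hu : Integrable (fun x => |groundTruth π x - u x|) π.fst :=
    (integrable_groundTruth.sub hui).abs
  rw [← integral_sub hv hu]
  refine abs_integral_le_integral_abs.trans
    (integral_mono (hv.sub hu).abs (hvi.sub hui).abs fun x => ?_)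
  refine (abs_abs_sub_abs_le_abs_sub _ _).trans (le_of_eq ?_)
  rw [sub_sub_sub_cancel_left, abs_sub_comm]

end CalibrationError

/-! ### Continuity on `L^p` -/

lemma integral_abs_sub_le_dist {α : Type*} [MeasurableSpace α] {μ : Measure α}
    [IsProbabilityMeasure μ] {p : ℝ≥0∞} [hp : Fact (1 ≤ p)] (f g : Lp ℝ p μ) :
    ∫ x, |f x - g x| ∂μ ≤ dist f g := by
  have hm : AEStronglyMeasurable (⇑f - ⇑g) μ :=
    (Lp.aestronglyMeasurable f).sub (Lp.aestronglyMeasurable g)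
  have h := lpNorm_one_eq_integral_norm hm
  simp only [Pi.sub_apply, Real.norm_eq_abs] at h
  rw [← h, ← toReal_eLpNorm hm, Lp.dist_def]
  exact ENNReal.toReal_mono ((Lp.memLp f).sub (Lp.memLp g)).eLpNorm_ne_top
    (eLpNorm_le_eLpNorm_of_exponent_le hp.out hm)

theorem mainTheorem1 {Ω : Type*} [TopologicalSpace Ω] [PolishSpace Ω] [MeasurableSpace Ω]
    [BorelSpace Ω] (π : Measure (Ω × Fin 2)) [IsProbabilityMeasure π]
    (p : ℝ≥0∞) [Fact (1 ≤ p)] (g : Lp ℝ p π.fst) :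
    ContinuousAt (fun f : Lp ℝ p π.fst => expectedCalibrationError π f) g ↔
      expectedCalibrationError π g = lpNorm (fun x => groundTruth π x - g x) 1 π.fst := by
  have hm (f : Lp ℝ p π.fst) : Measurable f := (Lp.stronglyMeasurable f).measurable
  have hi (f : Lp ℝ p π.fst) : Integrable f π.fst := (Lp.memLp f).integrable Fact.out
  rw [lpNorm_one_eq_integral_norm (f := fun x => groundTruth π x - g x)
    (measurable_groundTruth.sub (hm g)).aestronglyMeasurable]
  simp only [Real.norm_eq_abs]
  constructor
  · intro hcont
    refine le_antisymm (expectedCalibrationError_le (hm g) (hi g))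
      (le_of_forall_pos_le_add fun ε hε => ?_)
    obtain ⟨δ, hδ, hclose⟩ := Metric.continuousAt_iff.1 hcont (ε / 2) (half_pos hε)
    obtain ⟨v, hv, hvg, heq⟩ := exists_abs_sub_le_expectedCalibrationError_eq (π := π) (hm g)
      (η := min (δ / 2) (ε / 2)) (by positivity)
    have hvp : MemLp v p π.fst := by
      have hd : MemLp (v - ⇑g) p π.fst :=
        MemLp.of_bound (hv.sub (hm g)).aestronglyMeasurable _ (.of_forall hvg)
      simpa using hd.add (Lp.memLp g)
    have hae : hvp.toLp v =ᵐ[π.fst] v := hvp.coeFn_toLp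
    have hdist : dist (hvp.toLp v) g ≤ min (δ / 2) (ε / 2) := by
      rw [dist_eq_norm]
      refine (Lp.norm_le_of_ae_bound (C := min (δ / 2) (ε / 2)) (by positivity) ?_).trans
        (le_of_eq ?_)
      · filter_upwards [Lp.coeFn_sub (hvp.toLp v) g, hae] with x h1 h2
        rw [h1, Pi.sub_apply, h2]
        exact hvg x
      · simp [measureUnivNNReal]
    have hE := hclose (hdist.trans_lt ((min_le_left _ _).trans_lt (half_lt_self hδ)))
    rw [Real.dist_eq, expectedCalibrationError_congr π (hm _) hv hae, heq,
      ← integral_congr_ae (hae.mono fun x hx => congrArg (fun t => |groundTruth π x - t|) hx)]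
      at hE
    have hU := abs_integral_groundTruth_sub_sub_le (hi g) (hi (hvp.toLp v))
    have hL := (integral_abs_sub_le_dist (hvp.toLp v) g).trans
      (hdist.trans (min_le_right _ _))
    linarith [(abs_lt.1 hE).2, (abs_le.1 hU).1]
  · intro heq
    refine Metric.continuousAt_iff.2 fun ε hε => ?_
    obtain ⟨δ, hδ, hlow⟩ :=
      expectedCalibrationError_lowerSemicontinuous (hm g) (hi g) (half_pos hε)
    refine ⟨min δ ε, by positivity, fun {f} hf => ?_⟩
    have hL := (integral_abs_sub_le_dist f g).trans_lt hf
    have h1 := hlow f (hm f) (hi f) (hL.trans_le (min_le_left _ _))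
    have h2 := expectedCalibrationError_le (hm f) (hi f)
    have h3 := abs_integral_groundTruth_sub_sub_le (hi g) (hi f)
    rw [Real.dist_eq, abs_lt]
    constructor <;> linarith [(abs_le.1 h3).2, hL.trans_le (min_le_right _ _)]
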